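/- Let $n\ge 1$, $p\ge 0$, let $x_1,\dots,x_n\in\mathbb{R}^p$ be deterministic and let $y_1,\dots,y_n$ be independent (not necessarily identically distributed) random variables with values in $\{-1,1\}$. Assume $\max_{1\le i\le n}\|x_i\|_2\le R$. For $w\in\mathbb{R}^p$ put $$\hat J_0(w)=\frac1n\sum_{i=1}^n\log\bigl(1+\exp(-y_i\,w^\top x_i)\bigr),\qquad J_0(w)=\mathbb{E}\bigl[\hat J_0(w)\bigr],\qquad \hat J_\lambda(w)=\hat J_0(w)+\frac{\lambda}{2}\|w\|_2^2 .$$ Let $\delta\in(0,1)$ and $\lambda=19R^2\sqrt{\frac{\log(8/\delta)}{n}}$. Then $\hat J_\lambda$ has a global minimizer $\hat w_\lambda$, which is unique if $R>0$, and, with probability at least $1-\delta$, for all $w_0\in\mathbb{R}^p$ (and for every global minimizer $\hat w_\lambda$ in the degenerate case $R=0$), $$J_0(\hat w_\lambda)\le J_0(w_0)+\bigl(10+100R^2\|w_0\|_2^2\bigr)\sqrt{\frac{\log(8/\delta)}{n}} .$$ Here $J_0(\hat w_\lambda)$ is the value of the deterministic function $J_0$ at the random point $\hat w_\lambda$. 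-/

import Mathlib

open MeasureTheory ProbabilityTheory

noncomputable section

/-- Empirical logistic risk `(1/n) ∑ᵢ log (1 + exp (-yᵢ wᵀxᵢ))` of the vector `w`, for the data
`(xᵢ, yᵢ)`. -/
def empRisk {n p : ℕ} (x : Fin n → EuclideanSpace ℝ (Fin p)) (y : Fin n → ℝ)
    (w : EuclideanSpace ℝ (Fin p)) : ℝ :=
  (1 / (n : ℝ)) * ∑ i, Real.log (1 + Real.exp (-(y i * inner ℝ w (x i))))

/-- Empirical logistic risk with the ridge penalty `(lam / 2) ‖w‖²`. -/
def regEmpRisk {n p : ℕ} (x : Fin n → EuclideanSpace ℝ (Fin p)) (y : Fin n → ℝ) (lam : ℝ)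
    (w : EuclideanSpace ℝ (Fin p)) : ℝ :=
  empRisk x y w + lam / 2 * ‖w‖ ^ 2

/-- Generalization performance of a fixed `w`: the expectation of the empirical logistic risk over
the random outputs `y`, the inputs `x` being deterministic. -/
def expRisk {Ω : Type*} [MeasurableSpace Ω] (μ : Measure Ω) {n p : ℕ}
    (x : Fin n → EuclideanSpace ℝ (Fin p)) (y : Fin n → Ω → ℝ)
    (w : EuclideanSpace ℝ (Fin p)) : ℝ :=
  ∫ ω, empRisk x (fun i => y i ω) w ∂μ

/-- `v` is a global minimizer of the penalized empirical logistic risk. -/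
def IsRidgeLogisticEstimator {n p : ℕ} (x : Fin n → EuclideanSpace ℝ (Fin p)) (y : Fin n → ℝ)
    (lam : ℝ) (v : EuclideanSpace ℝ (Fin p)) : Prop :=
  ∀ w, regEmpRisk x y lam v ≤ regEmpRisk x y lam w

end

/-! For labels `±1` the logistic loss is a label-free function plus a term affine in the label.
Hence empirical minus expected risk is exactly linear in `w`, equal to `-⟪w, q⟫` with `q = S / n`
and `S = ∑ ((yᵢ - 𝔼 yᵢ) / 2) • xᵢ`. Minimality of the estimator and Young's inequality then bound
the excess risk by `lam * ‖w₀‖ ^ 2 + ‖q‖ ^ 2 / lam`, for all `w₀` at once: no covering or union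
bound is needed.

What remains is a dimension-free tail bound for `‖S‖`. Adding the summands one at a time, with
Hoeffding's lemma for each, gives `𝔼 exp (‖S‖ ^ 2 / (2 n R ^ 2)) ≤ e`, and Markov's inequality
concludes. -/

/-! ### Logistic loss; existence and uniqueness of the minimizer. -/

theorem log_one_add_exp_neg_mul_of_sign {y : ℝ} (hy : y = -1 ∨ y = 1) (z : ℝ) :
    Real.log (1 + Real.exp (-(y * z))) = Real.log (1 + Real.exp (-z)) + (1 - y) / 2 * z := by
  rcases hy with rfl | rfl
  · have h : 1 + Real.exp (-(-1 * z)) = (1 + Real.exp (-z)) * Real.exp z := by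
      rw [add_mul, ← Real.exp_add]; simp; ring
    rw [h, Real.log_mul (by positivity) (by positivity), Real.log_exp]; ring
  · simp

/-- With `u = exp (a / 2)` and `v = exp (b / 2)` this is Cauchy–Schwarz: `(1 + u v)² ≤ (1 + u²)(1 +
v²)`. -/
theorem log_one_add_exp_midpoint_le (a b : ℝ) :
    2 * Real.log (1 + Real.exp ((a + b) / 2)) ≤
      Real.log (1 + Real.exp a) + Real.log (1 + Real.exp b) := by
  rw [← Real.log_mul (by positivity) (by positivity)]
  have h2 : 2 * Real.log (1 + Real.exp ((a + b) / 2)) =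
      Real.log ((1 + Real.exp ((a + b) / 2)) ^ 2) := by
    rw [Real.log_pow]; norm_num
  rw [h2]
  apply Real.log_le_log (by positivity)
  have e : Real.exp ((a + b) / 2) = Real.exp (a / 2) * Real.exp (b / 2) := by
    rw [← Real.exp_add]; ring_nf
  have ea : Real.exp a = Real.exp (a / 2) ^ 2 := by
    rw [← Real.exp_nat_mul]; congr 1; push_cast; ring
  have eb : Real.exp b = Real.exp (b / 2) ^ 2 := by
    rw [← Real.exp_nat_mul]; congr 1; push_cast; ring
  rw [e, ea, eb]
  nlinarith [sq_nonneg (Real.exp (a / 2) - Real.exp (b / 2))]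

theorem empRisk_nonneg {n p : ℕ} (x : Fin n → EuclideanSpace ℝ (Fin p)) (y : Fin n → ℝ)
    (w : EuclideanSpace ℝ (Fin p)) : 0 ≤ empRisk x y w := by
  unfold empRisk
  refine mul_nonneg (by positivity) (Finset.sum_nonneg fun i _ => Real.log_nonneg ?_)
  linarith [Real.exp_pos (-(y i * inner ℝ w (x i)))]

theorem continuous_empRisk {n p : ℕ} (x : Fin n → EuclideanSpace ℝ (Fin p)) (y : Fin n → ℝ) :
    Continuous (empRisk x y) := by
  unfold empRisk
  refine continuous_const.mul (continuous_finsetSum _ fun i _ => Continuous.log ?_ ?_)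
  · fun_prop
  · intro w; positivity

theorem empRisk_midpoint_le {n p : ℕ} (x : Fin n → EuclideanSpace ℝ (Fin p)) (y : Fin n → ℝ)
    (v w : EuclideanSpace ℝ (Fin p)) :
    2 * empRisk x y ((1 / 2 : ℝ) • (v + w)) ≤ empRisk x y v + empRisk x y w := by
  unfold empRisk
  rw [mul_left_comm, ← mul_add, Finset.mul_sum, ← Finset.sum_add_distrib]
  refine mul_le_mul_of_nonneg_left (Finset.sum_le_sum fun i _ => ?_) (by positivity)
  refine le_trans (le_of_eq ?_) (log_one_add_exp_midpoint_le _ _)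
  rw [real_inner_smul_left, inner_add_left]
  ring_nf

theorem exists_isRidgeLogisticEstimator {n p : ℕ} (x : Fin n → EuclideanSpace ℝ (Fin p))
    (y : Fin n → ℝ) {lam : ℝ} (hlam : 0 < lam) : ∃ v, IsRidgeLogisticEstimator x y lam v := by
  refine Continuous.exists_forall_le (f := regEmpRisk x y lam) ?_ ?_
  · unfold regEmpRisk
    have := continuous_empRisk x y
    fun_prop
  · refine Filter.tendsto_atTop_mono (f := fun w => lam / 2 * ‖w‖ ^ 2) (fun w => ?_) ?_
    · have := empRisk_nonneg x y w
      unfold regEmpRisk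
      linarith
    · exact ((Filter.tendsto_pow_atTop two_ne_zero).comp
        (tendsto_norm_cocompact_atTop)).const_mul_atTop (by positivity)

/-- Comparing both minimizers with their midpoint, the parallelogram law leaves a strict gain from
the penalty unless they coincide. -/
theorem IsRidgeLogisticEstimator.unique {n p : ℕ} {x : Fin n → EuclideanSpace ℝ (Fin p)}
    {y : Fin n → ℝ} {lam : ℝ} (hlam : 0 < lam) {v w : EuclideanSpace ℝ (Fin p)}
    (hv : IsRidgeLogisticEstimator x y lam v) (hw : IsRidgeLogisticEstimator x y lam w) :
    v = w := by
  have h1 := hv ((1 / 2 : ℝ) • (v + w))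
  have h2 := hw ((1 / 2 : ℝ) • (v + w))
  have h3 := empRisk_midpoint_le x y v w
  unfold regEmpRisk at h1 h2
  have h4 := parallelogram_law_with_norm ℝ v w
  have h5 : ‖(1 / 2 : ℝ) • (v + w)‖ ^ 2 = ‖v + w‖ ^ 2 / 4 := by
    rw [norm_smul, mul_pow]; norm_num; ring
  rw [h5] at h1 h2
  have h6 : lam * ‖v - w‖ ^ 2 ≤ 0 := by
    have : ‖v + w‖ ^ 2 = 2 * (‖v‖ ^ 2 + ‖w‖ ^ 2) - ‖v - w‖ ^ 2 := by linarith
    rw [this] at h1 h2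
    linarith
  have h7 : ‖v - w‖ ^ 2 = 0 :=
    le_antisymm (nonpos_of_mul_nonpos_right h6 hlam) (sq_nonneg _)
  exact sub_eq_zero.1 (norm_eq_zero.1 (pow_eq_zero_iff two_ne_zero |>.1 h7))

/-! ### The linear fluctuation of the empirical risk. -/

theorem integrable_of_sign {Ω : Type*} [MeasurableSpace Ω] {μ : Measure Ω} [IsFiniteMeasure μ]
    {Y : Ω → ℝ} (hY : Measurable Y) (hval : ∀ ω, Y ω = -1 ∨ Y ω = 1) : Integrable Y μ :=
  Integrable.of_bound hY.aestronglyMeasurable 1 (.of_forall fun ω => by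
    rcases hval ω with h | h <;> simp [h])

theorem abs_integral_le_one_of_sign {Ω : Type*} [MeasurableSpace Ω] {μ : Measure Ω}
    [IsProbabilityMeasure μ] {Y : Ω → ℝ} (hval : ∀ ω, Y ω = -1 ∨ Y ω = 1) : |∫ ω, Y ω ∂μ| ≤ 1 := by
  have h := norm_integral_le_of_norm_le_const (μ := μ) (f := Y) (C := 1) (.of_forall fun ω => by
    rcases hval ω with h | h <;> simp [h])
  simpa using h

theorem norm_sum_centered_smul_le {Ω ι E : Type*} [MeasurableSpace Ω] {μ : Measure Ω}
    [IsProbabilityMeasure μ] [SeminormedAddCommGroup E] [NormedSpace ℝ E] {y : ι → Ω → ℝ}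
    (hy_val : ∀ i ω, y i ω = -1 ∨ y i ω = 1) (x : ι → E) (s : Finset ι) (ω : Ω) :
    ‖∑ i ∈ s, ((y i ω - ∫ ω', y i ω' ∂μ) / 2) • x i‖ ≤ ∑ i ∈ s, ‖x i‖ := by
  refine norm_sum_le_of_le _ fun j _ => ?_
  rw [norm_smul]
  refine mul_le_of_le_one_left (norm_nonneg _) ?_
  have hm := abs_le.1 (abs_integral_le_one_of_sign (μ := μ) (hy_val j))
  rw [Real.norm_eq_abs, abs_le]
  rcases hy_val j ω with h | h <;> rw [h] <;> constructor <;> linarith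

theorem empRisk_sub_expRisk {Ω : Type*} [MeasurableSpace Ω] (μ : Measure Ω)
    [IsProbabilityMeasure μ] {n p : ℕ} (x : Fin n → EuclideanSpace ℝ (Fin p))
    (y : Fin n → Ω → ℝ) (hy_meas : ∀ i, Measurable (y i))
    (hy_val : ∀ i ω, y i ω = -1 ∨ y i ω = 1) (ω : Ω) (w : EuclideanSpace ℝ (Fin p)) :
    empRisk x (fun i => y i ω) w - expRisk μ x y w =
      -(1 / (n : ℝ)) * inner ℝ w (∑ i, ((y i ω - ∫ ω', y i ω' ∂μ) / 2) • x i) := by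
  have key : ∀ ω, empRisk x (fun i => y i ω) w = (1 / (n : ℝ)) * ∑ i,
      (Real.log (1 + Real.exp (-inner ℝ w (x i))) + (1 - y i ω) / 2 * inner ℝ w (x i)) := by
    intro ω
    unfold empRisk
    simp_rw [fun i => log_one_add_exp_neg_mul_of_sign (hy_val i ω)]
  have hint : ∀ i, Integrable (y i) μ := fun i => integrable_of_sign (hy_meas i) (hy_val i)
  have hE : expRisk μ x y w = (1 / (n : ℝ)) * ∑ i,
      (Real.log (1 + Real.exp (-inner ℝ w (x i))) +
        (1 - ∫ ω', y i ω' ∂μ) / 2 * inner ℝ w (x i)) := by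
    unfold expRisk
    simp_rw [key]
    have hI : ∀ i, Integrable (fun ω => (1 - y i ω) / 2 * inner ℝ w (x i)) μ := fun i =>
      (((integrable_const 1).sub (hint i)).div_const 2).mul_const _
    rw [integral_const_mul, integral_finsetSum _ fun i _ => by
      exact (integrable_const _).add (hI i)]
    congr 1
    refine Finset.sum_congr rfl fun i _ => ?_
    rw [integral_add (integrable_const _) (hI i), integral_mul_const, integral_div,
      integral_sub (integrable_const _) (hint i)]
    simp
  rw [hE, key, ← mul_sub, ← Finset.sum_sub_distrib, inner_sum, neg_mul, ← mul_neg,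
    ← Finset.sum_neg_distrib]
  congr 1
  refine Finset.sum_congr rfl fun i _ => ?_
  rw [real_inner_smul_right]
  ring

/-! ### Concentration of the norm of the centered sum. -/

/-- Hoeffding's lemma for `Y / 2`, whose range has length 1, with the moment generating function
written as a two-point sum so that `t` may later depend on an independent variable. -/
theorem sign_mgf_le {Ω : Type*} [MeasurableSpace Ω] {μ : Measure Ω}
    [IsProbabilityMeasure μ] {Y : Ω → ℝ} (hY : Measurable Y) (hval : ∀ ω, Y ω = -1 ∨ Y ω = 1)
    (t : ℝ) :
    (1 + ∫ ω, Y ω ∂μ) / 2 * Real.exp (t * ((1 - ∫ ω, Y ω ∂μ) / 2)) +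
      (1 - ∫ ω, Y ω ∂μ) / 2 * Real.exp (t * ((-1 - ∫ ω, Y ω ∂μ) / 2)) ≤ Real.exp (t ^ 2 / 8) := by
  have h := (hasSubgaussianMGF_of_mem_Icc (μ := μ) (X := fun ω => Y ω / 2) (a := -(1 / 2))
    (b := 1 / 2) (hY.div_const 2).aemeasurable (.of_forall fun ω => by
      rcases hval ω with h | h <;> rw [h] <;> constructor <;> norm_num)).mgf_le t
  have hi := integrable_of_sign (μ := μ) hY hval
  set m := ∫ ω, Y ω ∂μ with hm
  have e : mgf (fun ω => Y ω / 2 - ∫ ω', Y ω' / 2 ∂μ) μ t =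
      ∫ ω, ((1 + Y ω) / 2 * Real.exp (t * ((1 - m) / 2)) +
        (1 - Y ω) / 2 * Real.exp (t * ((-1 - m) / 2))) ∂μ := by
    unfold mgf
    refine integral_congr_ae (.of_forall fun ω => ?_)
    simp only [integral_div, ← hm]
    rcases hval ω with h | h <;> rw [h] <;> ring_nf
  rw [e, integral_add (by exact (((integrable_const 1).add hi).div_const 2).mul_const _)
    (by exact (((integrable_const 1).sub hi).div_const 2).mul_const _), integral_mul_const,
    integral_mul_const, integral_div, integral_div, integral_add (integrable_const _) hi,
    integral_sub (integrable_const _) hi] at h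
  simp only [integral_const, probReal_univ, smul_eq_mul, one_mul] at h
  refine h.trans (le_of_eq ?_)
  congr 1
  push_cast
  norm_num
  ring

/-- Expand the square: the new summand's square costs `exp (c R²)`, and averaging the cross term
over `Y` with `Z` frozen costs at most `exp (c² R² ‖Z‖² / 2)`. -/
theorem integral_exp_norm_sq_add_le {Ω : Type*} [MeasurableSpace Ω] {μ : Measure Ω}
    [IsProbabilityMeasure μ] {p : ℕ} {Y : Ω → ℝ} (hY : Measurable Y)
    (hval : ∀ ω, Y ω = -1 ∨ Y ω = 1) {Z : Ω → EuclideanSpace ℝ (Fin p)} (hZ : Measurable Z)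
    {B : ℝ} (hB : ∀ ω, ‖Z ω‖ ≤ B) (hYZ : IndepFun Y Z μ) {x : EuclideanSpace ℝ (Fin p)} {R : ℝ}
    (hx : ‖x‖ ≤ R) {c : ℝ} (hc : 0 ≤ c) :
    ∫ ω, Real.exp (c * ‖Z ω + ((Y ω - ∫ ω', Y ω' ∂μ) / 2) • x‖ ^ 2) ∂μ ≤
      Real.exp (c * R ^ 2) * ∫ ω, Real.exp ((c + c ^ 2 * R ^ 2 / 2) * ‖Z ω‖ ^ 2) ∂μ := by
  have hi := integrable_of_sign (μ := μ) hY hval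
  have hmgf := sign_mgf_le (μ := μ) hY hval
  have hm1 := abs_le.1 (abs_integral_le_one_of_sign (μ := μ) hval)
  set m := ∫ ω, Y ω ∂μ with hm
  have hR : 0 ≤ R := (norm_nonneg x).trans hx
  have hcont : ∀ g : EuclideanSpace ℝ (Fin p) → ℝ, Continuous g →
      Integrable (fun ω => g (Z ω)) μ := by
    intro g hg
    obtain ⟨C, hC⟩ := (isCompact_closedBall (0 : EuclideanSpace ℝ (Fin p)) B).exists_bound_of_continuousOn
      hg.continuousOn
    exact Integrable.of_bound (hg.measurable.comp hZ).aestronglyMeasurable C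
      (.of_forall fun ω => hC _ (by simpa using hB ω))
  -- As `Y = ±1`, `a Y Z` is affine in `Y` with coefficients depending on `Z`, so independence is
  -- only used on products.
  let a : ℝ → EuclideanSpace ℝ (Fin p) → ℝ := fun s z =>
    Real.exp (c * ‖z‖ ^ 2) * Real.exp (2 * c * inner ℝ z x * ((s - m) / 2))
  have ha : ∀ s, Continuous (a s) := fun s => by unfold a; fun_prop
  have hprodint : ∀ s u v : ℝ, Integrable (fun ω => (u + v * Y ω) / 2 * a s (Z ω)) μ := by
    intro s u v
    refine Integrable.bdd_mul (c := (|u| + |v|) / 2) (hcont _ (ha s))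
      (by fun_prop) (.of_forall fun ω => ?_)
    rw [Real.norm_eq_abs, abs_div, abs_two]
    gcongr
    refine (abs_add_le _ _).trans ?_
    rcases hval ω with h | h <;> simp [h]
  have hprod : ∀ s u v : ℝ, ∫ ω, (u + v * Y ω) / 2 * a s (Z ω) ∂μ =
      (u + v * m) / 2 * ∫ ω, a s (Z ω) ∂μ := by
    intro s u v
    have hind : IndepFun (fun ω => (u + v * Y ω) / 2) (fun ω => a s (Z ω)) μ :=
      hYZ.comp (φ := fun r => (u + v * r) / 2) (by fun_prop) (ha s).measurable
    rw [hind.integral_fun_mul_eq_mul_integral (by fun_prop)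
      ((ha s).measurable.comp hZ).aestronglyMeasurable, integral_div,
      integral_add (integrable_const _) (hi.const_mul v), integral_const_mul]
    simp [hm]
  calc ∫ ω, Real.exp (c * ‖Z ω + ((Y ω - m) / 2) • x‖ ^ 2) ∂μ
      ≤ ∫ ω, Real.exp (c * R ^ 2) * ((1 + 1 * Y ω) / 2 * a 1 (Z ω) +
          (1 + (-1) * Y ω) / 2 * a (-1) (Z ω)) ∂μ := by
        refine integral_mono_of_nonneg (.of_forall fun ω => (Real.exp_pos _).le)
          (((hprodint _ _ _).add (hprodint _ _ _)).const_mul _) (.of_forall fun ω => ?_)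
        have e : (1 + 1 * Y ω) / 2 * a 1 (Z ω) + (1 + (-1) * Y ω) / 2 * a (-1) (Z ω) =
            a (Y ω) (Z ω) := by
          rcases hval ω with h | h <;> rw [h] <;> ring
        simp only [e, a]
        rw [← Real.exp_add, ← Real.exp_add, Real.exp_le_exp, norm_add_sq_real, norm_smul,
          real_inner_smul_right, mul_pow, Real.norm_eq_abs, sq_abs]
        have hξ : ((Y ω - m) / 2) ^ 2 ≤ 1 := by
          rcases hval ω with h | h <;> rw [h] <;> nlinarith
        have hxx : ‖x‖ ^ 2 ≤ R ^ 2 := by gcongr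
        have : c * (((Y ω - m) / 2) ^ 2 * ‖x‖ ^ 2) ≤ c * (1 * R ^ 2) := by gcongr
        linarith
    _ = Real.exp (c * R ^ 2) * ∫ ω, ((1 + m) / 2 * a 1 (Z ω) + (1 - m) / 2 * a (-1) (Z ω)) ∂μ := by
        rw [integral_const_mul, integral_add (hprodint _ _ _) (hprodint _ _ _), hprod, hprod,
          integral_add ((hcont _ (ha _)).const_mul _) ((hcont _ (ha _)).const_mul _),
          integral_const_mul, integral_const_mul]
        ring_nf
    _ ≤ _ := by
        refine mul_le_mul_of_nonneg_left (integral_mono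
          (((hcont _ (ha _)).const_mul _).add ((hcont _ (ha _)).const_mul _))
          (hcont (fun z => Real.exp ((c + c ^ 2 * R ^ 2 / 2) * ‖z‖ ^ 2)) (by fun_prop))
          fun ω => ?_) (Real.exp_pos _).le
        have h1 := hmgf (2 * c * inner ℝ (Z ω) x)
        have h2 : (inner ℝ (Z ω) x) ^ 2 ≤ ‖Z ω‖ ^ 2 * R ^ 2 := by
          rw [← mul_pow, ← sq_abs]
          have := (abs_real_inner_le_norm (Z ω) x).trans
            (mul_le_mul_of_nonneg_left hx (norm_nonneg _))
          gcongr
        calc (1 + m) / 2 * a 1 (Z ω) + (1 - m) / 2 * a (-1) (Z ω)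
            = Real.exp (c * ‖Z ω‖ ^ 2) *
              ((1 + m) / 2 * Real.exp (2 * c * inner ℝ (Z ω) x * ((1 - m) / 2)) +
              (1 - m) / 2 * Real.exp (2 * c * inner ℝ (Z ω) x * ((-1 - m) / 2))) := by
              simp only [a]; ring
          _ ≤ Real.exp (c * ‖Z ω‖ ^ 2) * Real.exp ((2 * c * inner ℝ (Z ω) x) ^ 2 / 8) := by
              gcongr
          _ ≤ Real.exp ((c + c ^ 2 * R ^ 2 / 2) * ‖Z ω‖ ^ 2) := by
              rw [← Real.exp_add, Real.exp_le_exp]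
              have : c ^ 2 * (inner ℝ (Z ω) x) ^ 2 ≤ c ^ 2 * (‖Z ω‖ ^ 2 * R ^ 2) := by gcongr
              linarith

/-- The exponent shrinks with `s.card` so that the increase `c ↦ c + c² R² / 2` at each step is
absorbed, while each new term costs a factor of at most `exp (1 / n)`. -/
theorem integral_exp_norm_sq_sum_le {Ω : Type*} [MeasurableSpace Ω] {μ : Measure Ω}
    [IsProbabilityMeasure μ] {n p : ℕ} (hn : 0 < n) {x : Fin n → EuclideanSpace ℝ (Fin p)}
    {y : Fin n → Ω → ℝ} (hy_meas : ∀ i, Measurable (y i))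
    (hy_val : ∀ i ω, y i ω = -1 ∨ y i ω = 1) (hy_indep : iIndepFun y μ) {R : ℝ} (hR : 0 < R)
    (hx : ∀ i, ‖x i‖ ≤ R) (s : Finset (Fin n)) :
    ∫ ω, Real.exp (1 / (R ^ 2 * (n + s.card)) *
      ‖∑ i ∈ s, ((y i ω - ∫ ω', y i ω' ∂μ) / 2) • x i‖ ^ 2) ∂μ ≤ Real.exp (s.card / n) := by
  induction s using Finset.induction_on with
  | empty => simp
  | insert i s his ih =>
    have hn' : (0 : ℝ) < n := by exact_mod_cast hn
    have hmeas : Measurable fun ω => ∑ j ∈ s, ((y j ω - ∫ ω', y j ω' ∂μ) / 2) • x j := by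
      fun_prop
    have hbound := norm_sum_centered_smul_le (μ := μ) hy_val x s
    have hind : IndepFun (y i) (fun ω => ∑ j ∈ s, ((y j ω - ∫ ω', y j ω' ∂μ) / 2) • x j) μ := by
      have h := hy_indep.indepFun_finset {i} s (by simpa using his) hy_meas
      have hφ : Measurable fun f : ({i} : Finset (Fin n)) → ℝ => f ⟨i, by simp⟩ :=
        measurable_pi_apply _
      have hψ : Measurable fun f : s → ℝ =>
          ∑ j : s, ((f j - ∫ ω', y j ω' ∂μ) / 2) • x j := by fun_prop
      have h' := h.comp hφ hψ
      convert h' using 1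
      · rfl
      funext ω
      exact (Finset.sum_coe_sort s fun j => ((y j ω - ∫ ω', y j ω' ∂μ) / 2) • x j).symm
    have hcard : ((insert i s).card : ℝ) = s.card + 1 := by
      rw [Finset.card_insert_of_notMem his]; push_cast; ring
    rw [hcard]
    have hs : (0 : ℝ) ≤ s.card := by positivity
    set k : ℝ := (s.card : ℝ)
    simp_rw [Finset.sum_insert his, fun ω => add_comm (((y i ω - ∫ ω', y i ω' ∂μ) / 2) • x i)]
    refine (integral_exp_norm_sq_add_le (hy_meas i) (hy_val i) hmeas hbound hind (hx i)
      (c := 1 / (R ^ 2 * (n + (k + 1)))) (by positivity)).trans ?_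
    have e1 : Real.exp (1 / (R ^ 2 * (n + (k + 1))) * R ^ 2) ≤ Real.exp (1 / n) := by
      rw [Real.exp_le_exp]
      have : 1 / (R ^ 2 * (n + (k + 1))) * R ^ 2 = 1 / (n + (k + 1)) := by field_simp
      rw [this]
      gcongr
      linarith
    have e2 : 1 / (R ^ 2 * (n + (k + 1))) + (1 / (R ^ 2 * (n + (k + 1)))) ^ 2 * R ^ 2 / 2 ≤
        1 / (R ^ 2 * (n + k)) := by
      -- Essentially `1 / q - 1 / (q + 1) = 1 / (q (q + 1)) ≥ 1 / (2 (q + 1)²)`.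
      have hq : 0 < (n : ℝ) + k := by linarith
      generalize hqq : (n : ℝ) + k = q at hq
      rw [← add_assoc, hqq]
      have : 1 / (R ^ 2 * q) - (1 / (R ^ 2 * (q + 1)) +
          (1 / (R ^ 2 * (q + 1))) ^ 2 * R ^ 2 / 2) = (q + 2) / (2 * R ^ 2 * q * (q + 1) ^ 2) := by
        field_simp
        ring
      have h0 : 0 ≤ (q + 2) / (2 * R ^ 2 * q * (q + 1) ^ 2) := by positivity
      linarith
    have hexp : Real.exp ((k + 1) / n) = Real.exp (1 / n) * Real.exp (k / n) := by
      rw [← Real.exp_add]; ring_nf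
    rw [hexp]
    refine mul_le_mul e1 (le_trans (integral_mono_of_nonneg
      (.of_forall fun ω => (Real.exp_pos _).le) ?_ (.of_forall fun ω => ?_)) ih)
      (integral_nonneg fun ω => (Real.exp_pos _).le) (Real.exp_pos _).le
    · refine Integrable.of_bound (by fun_prop)
        (Real.exp (1 / (R ^ 2 * (n + k)) * (∑ j ∈ s, ‖x j‖) ^ 2)) (.of_forall fun ω => ?_)
      rw [Real.norm_eq_abs, Real.abs_exp, Real.exp_le_exp]
      have := hbound ω
      gcongr
    · dsimp only
      gcongr

theorem measureReal_le_norm_sq_sum_le {Ω : Type*} [MeasurableSpace Ω] {μ : Measure Ω}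
    [IsProbabilityMeasure μ] {n p : ℕ} (hn : 0 < n) {x : Fin n → EuclideanSpace ℝ (Fin p)}
    {y : Fin n → Ω → ℝ} (hy_meas : ∀ i, Measurable (y i))
    (hy_val : ∀ i ω, y i ω = -1 ∨ y i ω = 1) (hy_indep : iIndepFun y μ) {R : ℝ} (hR : 0 < R)
    (hx : ∀ i, ‖x i‖ ≤ R) {t : ℝ} :
    μ.real {ω | 2 * n * R ^ 2 * t ≤ ‖∑ i, ((y i ω - ∫ ω', y i ω' ∂μ) / 2) • x i‖ ^ 2} ≤
      Real.exp (1 - t) := by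
  have hn' : (0 : ℝ) < n := by exact_mod_cast hn
  have h := integral_exp_norm_sq_sum_le hn hy_meas hy_val hy_indep hR hx Finset.univ
  rw [Finset.card_univ, Fintype.card_fin, div_self hn'.ne'] at h
  have hint : Integrable (fun ω => Real.exp (1 / (R ^ 2 * (n + n)) *
      ‖∑ i, ((y i ω - ∫ ω', y i ω' ∂μ) / 2) • x i‖ ^ 2)) μ := by
    refine Integrable.of_bound (by fun_prop)
      (Real.exp (1 / (R ^ 2 * (n + n)) * (∑ i, ‖x i‖) ^ 2)) (.of_forall fun ω => ?_)
    rw [Real.norm_eq_abs, Real.abs_exp, Real.exp_le_exp]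
    have := norm_sum_centered_smul_le (μ := μ) hy_val x Finset.univ ω
    gcongr
  have hmk := mul_meas_ge_le_integral_of_nonneg (.of_forall fun ω => (Real.exp_pos _).le) hint
    (Real.exp t)
  rw [Real.exp_sub, le_div_iff₀ (Real.exp_pos t), mul_comm]
  refine le_trans (mul_le_mul_of_nonneg_left (measureReal_mono ?_) (Real.exp_pos _).le)
    (hmk.trans h)
  intro ω hω
  simp only [Set.mem_ofPred_eq, Real.exp_le_exp] at hω ⊢
  rw [one_div, inv_mul_eq_div, le_div_iff₀ (by positivity)]
  linarith

/-! ### Deterministic risk bound and conclusion. -/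

theorem expRisk_le_of_isRidgeLogisticEstimator {Ω : Type*} [MeasurableSpace Ω] (μ : Measure Ω)
    [IsProbabilityMeasure μ] {n p : ℕ} {x : Fin n → EuclideanSpace ℝ (Fin p)}
    {y : Fin n → Ω → ℝ} (hy_meas : ∀ i, Measurable (y i))
    (hy_val : ∀ i ω, y i ω = -1 ∨ y i ω = 1) {lam : ℝ} (hlam : 0 < lam) {ω : Ω}
    {v : EuclideanSpace ℝ (Fin p)} (hv : IsRidgeLogisticEstimator x (fun i => y i ω) lam v)
    (w : EuclideanSpace ℝ (Fin p)) :
    expRisk μ x y v ≤ expRisk μ x y w + lam * ‖w‖ ^ 2 +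
      ‖(1 / (n : ℝ)) • ∑ i, ((y i ω - ∫ ω', y i ω' ∂μ) / 2) • x i‖ ^ 2 / lam := by
  have h := hv w
  have h1 := empRisk_sub_expRisk μ x y hy_meas hy_val ω v
  have h2 := empRisk_sub_expRisk μ x y hy_meas hy_val ω w
  rw [neg_mul, ← real_inner_smul_right] at h1 h2
  set q := (1 / (n : ℝ)) • ∑ i, ((y i ω - ∫ ω', y i ω' ∂μ) / 2) • x i
  unfold regEmpRisk at h
  -- With this weight, the term in `‖v‖²` cancels the penalty at `v`.
  have young : ∀ u : EuclideanSpace ℝ (Fin p),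
      |inner ℝ u q| ≤ lam / 2 * ‖u‖ ^ 2 + ‖q‖ ^ 2 / lam / 2 := by
    intro u
    refine (abs_real_inner_le_norm u q).trans ?_
    have : lam / 2 * ‖u‖ ^ 2 + ‖q‖ ^ 2 / lam / 2 - ‖u‖ * ‖q‖ =
        (lam * ‖u‖ - ‖q‖) ^ 2 / (2 * lam) := by
      field_simp; ring
    have h0 : 0 ≤ (lam * ‖u‖ - ‖q‖) ^ 2 / (2 * lam) := by positivity
    linarith
  have h3 := (abs_le.1 (young v)).2
  have h4 := (abs_le.1 (young w)).1
  linarith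

theorem theorem1 {Ω : Type*} [MeasurableSpace Ω] (μ : Measure Ω) [IsProbabilityMeasure μ]
    (n p : ℕ) (hn : 0 < n)
    (x : Fin n → EuclideanSpace ℝ (Fin p)) (y : Fin n → Ω → ℝ)
    (hy_meas : ∀ i, Measurable (y i))
    (hy_val : ∀ i ω, y i ω = -1 ∨ y i ω = 1)
    (hy_indep : iIndepFun y μ)
    (R : ℝ) (hx : ∀ i, ‖x i‖ ≤ R)
    (δ : ℝ) (hδ_pos : 0 < δ) (hδ_lt : δ < 1)
    (lam : ℝ) (hlam : lam = 19 * R ^ 2 * Real.sqrt (Real.log (8 / δ) / n)) :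
    (∀ ω, (∃ v, IsRidgeLogisticEstimator x (fun i => y i ω) lam v) ∧
      (0 < R → ∃! v, IsRidgeLogisticEstimator x (fun i => y i ω) lam v)) ∧
    ENNReal.ofReal (1 - δ) ≤
      μ {ω | ∀ v, IsRidgeLogisticEstimator x (fun i => y i ω) lam v →
        ∀ w₀ : EuclideanSpace ℝ (Fin p),
          expRisk μ x y v ≤ expRisk μ x y w₀ +
            (10 + 100 * R ^ 2 * ‖w₀‖ ^ 2) * Real.sqrt (Real.log (8 / δ) / n)} := by
  have hn' : (0 : ℝ) < n := by exact_mod_cast hn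
  have hL : 1 < Real.log (8 / δ) := by
    rw [Real.lt_log_iff_exp_lt (by positivity), lt_div_iff₀ hδ_pos]
    nlinarith [Real.exp_one_lt_d9, Real.exp_pos 1]
  have hR : 0 ≤ R := (norm_nonneg _).trans (hx ⟨0, hn⟩)
  have hs : 0 < Real.sqrt (Real.log (8 / δ) / n) := Real.sqrt_pos.2 (by positivity)
  have hs2 : Real.sqrt (Real.log (8 / δ) / n) ^ 2 = Real.log (8 / δ) / n :=
    Real.sq_sqrt (by positivity)
  set s := Real.sqrt (Real.log (8 / δ) / n)
  rcases hR.eq_or_lt with rfl | hR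
  -- If `R = 0`, all inputs and `lam` vanish and the risks are constant in `w`.
  · have hx0 : ∀ i, x i = 0 := fun i => norm_le_zero_iff.1 (hx i)
    have hemp : ∀ (z : Fin n → ℝ) v w, empRisk x z v = empRisk x z w := by
      intro z v w
      simp [empRisk, hx0]
    have hlam0 : lam = 0 := by rw [hlam]; ring
    refine ⟨fun ω => ⟨⟨0, fun w => ?_⟩, fun h => absurd h (lt_irrefl _)⟩, ?_⟩
    · simp [regEmpRisk, hlam0, hemp _ 0 w]
    · have : {ω | ∀ v, IsRidgeLogisticEstimator x (fun i => y i ω) lam v →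
          ∀ w₀ : EuclideanSpace ℝ (Fin p), expRisk μ x y v ≤ expRisk μ x y w₀ +
            (10 + 100 * (0 : ℝ) ^ 2 * ‖w₀‖ ^ 2) * s} = Set.univ := by
        refine Set.eq_univ_of_forall fun ω v _ w => ?_
        have : expRisk μ x y v = expRisk μ x y w := by
          unfold expRisk
          exact integral_congr_ae (.of_forall fun ω => hemp _ v w)
        rw [this]
        have : 0 ≤ (10 + 100 * (0 : ℝ) ^ 2 * ‖w‖ ^ 2) * s := by positivity
        linarith
      rw [this, measure_univ]
      exact ENNReal.ofReal_le_one.2 (by linarith)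
  · have hlam_pos : 0 < lam := by rw [hlam]; positivity
    refine ⟨fun ω => ?_, ?_⟩
    · obtain ⟨v, hv⟩ := exists_isRidgeLogisticEstimator x (fun i => y i ω) hlam_pos
      exact ⟨⟨v, hv⟩, fun _ => ⟨v, hv, fun w hw => hw.unique hlam_pos hv⟩⟩
    · let S : Ω → EuclideanSpace ℝ (Fin p) :=
        fun ω => ∑ i, ((y i ω - ∫ ω', y i ω' ∂μ) / 2) • x i
      have hSm : Measurable S := by unfold S; fun_prop
      -- The tail level is `t = 2 L` with `L = log (8 / δ) > 1`, so `exp (1 - t) ≤ exp (-L) = δ /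
      -- 8`.
      let A : Set Ω := {ω | 2 * n * R ^ 2 * (2 * Real.log (8 / δ)) ≤ ‖S ω‖ ^ 2}
      have hAm : MeasurableSet A := measurableSet_le measurable_const (hSm.norm.pow_const 2)
      have hA : μ.real A ≤ δ := by
        refine (measureReal_le_norm_sq_sum_le hn hy_meas hy_val hy_indep hR hx).trans ?_
        have : Real.exp (1 - 2 * Real.log (8 / δ)) ≤ Real.exp (-Real.log (8 / δ)) :=
          Real.exp_le_exp.2 (by linarith)
        refine this.trans ?_
        rw [Real.exp_neg, Real.exp_log (by positivity), inv_div]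
        linarith
      have hAc : ENNReal.ofReal (1 - δ) ≤ μ Aᶜ := by
        rw [← ofReal_measureReal]
        refine ENNReal.ofReal_le_ofReal ?_
        rw [probReal_compl_eq_one_sub hAm]
        linarith
      refine hAc.trans (measure_mono fun ω hω v hv w => ?_)
      have hω' : ‖S ω‖ ^ 2 ≤ 2 * n * R ^ 2 * (2 * Real.log (8 / δ)) := 
        (not_le.1 fun h => hω h).le
      have h := expRisk_le_of_isRidgeLogisticEstimator μ hy_meas hy_val hlam_pos hv w
      change _ ≤ _ + _ + ‖(1 / (n : ℝ)) • S ω‖ ^ 2 / lam at h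
      -- The constants are slack: the argument gives `4 / 19` here, and `19` in place of `100`
      -- below.
      have hq : ‖(1 / (n : ℝ)) • S ω‖ ^ 2 / lam ≤ 10 * s := by
        rw [div_le_iff₀ hlam_pos, norm_smul, mul_pow, Real.norm_eq_abs, sq_abs, hlam]
        calc (1 / (n : ℝ)) ^ 2 * ‖S ω‖ ^ 2
            ≤ (1 / (n : ℝ)) ^ 2 * (2 * n * R ^ 2 * (2 * Real.log (8 / δ))) := by gcongr
          _ = 4 * R ^ 2 * (Real.log (8 / δ) / n) := by field_simp; ring
          _ = 4 * R ^ 2 * s ^ 2 := by rw [hs2]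
          _ ≤ 10 * s * (19 * R ^ 2 * s) := by nlinarith [mul_pos (pow_pos hR 2) (pow_pos hs 2)]
      have hw : lam * ‖w‖ ^ 2 ≤ 100 * R ^ 2 * ‖w‖ ^ 2 * s := by
        rw [hlam]
        have : 0 ≤ R ^ 2 * ‖w‖ ^ 2 * s := by positivity
        linarith
      linarith
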